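/- Let $d\ge 1$. Say that a set $S\subseteq\mathbb{R}^d$ has the *generic intersection property* if there is $D\in\mathbb{N}$ such that for every affine subspace $\Lambda\subseteq\mathbb{R}^d$ of dimension $k\ge 1$ (including $\Lambda=\mathbb{R}^d$) and all distinct $x_1,\dots,x_k\in\mathbb{R}^d$, $$\left|\bigcap_{i=1}^{k}\big((S\cap\Lambda)-x_i\big)\right|\le D.$$ **Theorem 1.6.** Suppose that $S\subseteq\mathbb{R}^d$ has the generic intersection property. Then there is a constant $C_S$, depending only on $S$, such that the following holds for every $n\ge 1$ and all nonzero vectors $a_1,\dots,a_n\in\mathbb{R}^d$. Let $X=a_1\xi_1+\dots+a_n\xi_n$, where $\xi_1,\dots,\xi_n$ are i.i.d. Rademacher random variables (each equal to $1$ or $-1$ with probability $1/2$). Then 1. $\Pr(X\in S)\le C_S\,n^{-1/2}$, and 2. $\Pr(X\in S)\le C_S\,\rho^{1/(d+1)}$, where $\rho=\max_{x\in\mathbb{R}^d}\Pr(X=x)$. -/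

import Mathlib

open MeasureTheory ProbabilityTheory

/-- The Rademacher distribution: the uniform distribution on `{1, -1} ⊆ ℝ`. -/
noncomputable def rademacher : Measure ℝ :=
  (2⁻¹ : ENNReal) • Measure.dirac (1 : ℝ) + (2⁻¹ : ENNReal) • Measure.dirac (-1 : ℝ)

/-- `S ⊆ ℝ^d` has the generic intersection property if there is `D ∈ ℕ` such that, for every affine
subspace `Λ` of `ℝ^d` of dimension `k ≥ 1` (including `Λ = ℝ^d`) and all distinct
`x₁, …, x_k ∈ ℝ^d`, the intersection `⋂ i, ((S ∩ Λ) - x_i)` has at most `D` points.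
(For `k = 0` there would be no sets to intersect.) -/
def GenericIntersectionProperty {d : ℕ} (S : Set (EuclideanSpace ℝ (Fin d))) : Prop :=
  ∃ D : ℕ, ∀ Λ : AffineSubspace ℝ (EuclideanSpace ℝ (Fin d)),
    1 ≤ Module.finrank ℝ Λ.direction →
      ∀ x : Fin (Module.finrank ℝ Λ.direction) → EuclideanSpace ℝ (Fin d),
        Function.Injective x →
          (⋂ i, {y | y + x i ∈ S ∩ (Λ : Set (EuclideanSpace ℝ (Fin d)))}).encard ≤ (D : ℕ∞)

/-- The point concentration `max_x Pr(X = x)` of a random vector `X`, as a supremum of real numbers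
in `[0, 1]`; it is attained whenever `X` almost surely takes only finitely many values, as signed
sums do. -/
noncomputable def maxPointProb {Ω E : Type*} [MeasurableSpace Ω] (μ : Measure Ω)
    (X : Ω → E) : ℝ :=
  ⨆ x : E, μ.real {ω | X ω = x}

/-!
Let `d` be the dimension and `X = Y + Z` a splitting of the signed sum into two independent parts.
For fixed `Y`, the event that `Y + Z₁, …, Y + Z_k ∈ S` for independent copies `Z_i` of `Z` has
probability about `Pr(Y + Z ∈ S | Y) ^ k`, once repetitions among the `Z_i`, each of probability at
most `max Pr(Z = z)`, are discarded. For distinct `Z_i` the generic intersection property leaves at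
most `D` values for `Y`. Jensen's inequality then gives the central estimate
`expect_mul_indicator_le`: if `Pr(Z = z) ≤ c` and `Pr(Y = y) ≤ 2 c ^ k` for all `y` and `z`, then
`Pr(Y + Z ∈ S) = O(c)`. It holds when `Y`, `Z` live in a `k`-dimensional space `V` and
translates of `S` by vectors of `V` are intersected inside a coset of `V`.

For the bound by `ρ ^ (1 / (d + 1))`, put `r = ρ ^ (1 / (d + 1))` and take for `Z` a partial sum
whose point concentration lies between `r / 2` and `r` (`exists_subset_concentration`). Since
`Pr(Y = y) Pr(Z = z) ≤ ρ`, the rest has concentration at most `2 r ^ d`, and the estimate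
applies with `k = d`.

For the bound by `n ^ (-1/2)`, a greedy extraction with a descent on the dimension
(`exists_isDisjointBases`) finds, for some `m` of order `n`, a family of `2 m` disjoint bases of one
common subspace `V ≠ 0` among the steps. Conditioning on the other steps translates `S`. Halász's
bound (`coeff_prod_signStep_le`) makes the concentration of the sum over `m` disjoint bases of `V`
at most `m ^ (-k/2)` for `k = dim V`, and the estimate applies with `c = m ^ (-1/2)`. Halász's bound
is derived without Fourier analysis: for `m` a power of two, iterated Cauchy–Schwarz in the group
algebra compares a convolution of `m` distinct symmetric laws with the return probabilities of their
`m`-fold powers (`coeff_prod_pow_le`), and for a basis this return probability is a product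
of those of one-dimensional simple random walks.
-/

open AddMonoidAlgebra

/-! ### Finitely supported laws in the group algebra -/

section Expectation

variable {E : Type*}

/-- The expectation `∑ x, f x * φ x` of `φ` under a finitely supported signed measure on `E`.
Such measures are encoded as elements of the group algebra `AddMonoidAlgebra ℝ E`, so that the
product is convolution, i.e. the law of the sum of two independent random vectors. -/
noncomputable def expect (f : AddMonoidAlgebra ℝ E) (φ : E → ℝ) : ℝ :=
  f.coeff.sum fun x c => c * φ x

lemma expect_eq_sum (f : AddMonoidAlgebra ℝ E) (φ : E → ℝ) :
    expect f φ = ∑ x ∈ f.coeff.support, f.coeff x * φ x := rfl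

lemma expect_add (f g : AddMonoidAlgebra ℝ E) (φ : E → ℝ) :
    expect (f + g) φ = expect f φ + expect g φ := by
  unfold expect
  rw [coeff_add, Finsupp.sum_add_index'] <;> simp [add_mul]

lemma expect_single (x : E) (c : ℝ) (φ : E → ℝ) : expect (single x c) φ = c * φ x := by
  simp [expect]

lemma expect_sum {ι : Type*} (s : Finset ι) (f : ι → AddMonoidAlgebra ℝ E) (φ : E → ℝ) :
    expect (∑ i ∈ s, f i) φ = ∑ i ∈ s, expect (f i) φ := by
  classical
  induction s using Finset.induction_on with
  | empty => simp [expect]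
  | insert i s hi ih => rw [Finset.sum_insert hi, Finset.sum_insert hi, expect_add, ih]

lemma expect_const (f : AddMonoidAlgebra ℝ E) (c : ℝ) :
    expect f (fun _ => c) = expect f (fun _ => 1) * c := by
  simp [expect_eq_sum, Finset.sum_mul]

lemma expect_mono {f : AddMonoidAlgebra ℝ E} (hf : ∀ x, 0 ≤ f.coeff x) {φ ψ : E → ℝ}
    (h : ∀ x, φ x ≤ ψ x) : expect f φ ≤ expect f ψ :=
  Finset.sum_le_sum fun x _ => mul_le_mul_of_nonneg_left (h x) (hf x)

open Classical in
lemma expect_indicator_singleton (f : AddMonoidAlgebra ℝ E) (x : E) :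
    expect f (fun y => if y = x then 1 else 0) = f.coeff x := by
  simp [expect_eq_sum]
  tauto

/-- `f` is a finitely supported probability measure on `E`. -/
structure IsLaw (f : AddMonoidAlgebra ℝ E) : Prop where
  nonneg : ∀ x, 0 ≤ f.coeff x
  total : expect f (fun _ => 1) = 1

lemma IsLaw.expect_le {f : AddMonoidAlgebra ℝ E} (hf : IsLaw f) {φ : E → ℝ} {c : ℝ}
    (h : ∀ x, φ x ≤ c) : expect f φ ≤ c := by
  have := expect_mono hf.nonneg h
  rwa [expect_const, hf.total, one_mul] at this

lemma IsLaw.exists_coeff_pos {f : AddMonoidAlgebra ℝ E} (hf : IsLaw f) :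
    ∃ x, 0 < f.coeff x := by
  by_contra! h
  have := hf.total
  rw [expect_eq_sum, Finset.sum_eq_zero fun x _ => by rw [(h x).antisymm (hf.nonneg x), zero_mul]]
    at this
  exact zero_ne_one this

variable [AddCommGroup E]

lemma expect_mul (f g : AddMonoidAlgebra ℝ E) (φ : E → ℝ) :
    expect (f * g) φ = expect f fun x => expect g fun y => φ (x + y) := by
  induction f using AddMonoidAlgebra.induction_linear with
  | zero => simp [expect]
  | add f₁ f₂ h₁ h₂ => rw [add_mul, expect_add, expect_add, h₁, h₂]
  | single x c =>
    induction g using AddMonoidAlgebra.induction_linear with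
    | zero => simp [expect]
    | add g₁ g₂ h₁ h₂ =>
      rw [mul_add, expect_add, h₁, h₂, expect_single, expect_single, expect_single, expect_add]
      ring
    | single y e => rw [single_mul_single, expect_single, expect_single, expect_single]; ring

lemma coeff_mul_eq_sum (f g : AddMonoidAlgebra ℝ E) (x : E) :
    (f * g).coeff x = ∑ y ∈ f.coeff.support, f.coeff y * g.coeff (x - y) := by
  rw [coeff_mul_apply_left]
  simp only [Finsupp.sum, neg_add_eq_sub]

lemma IsLaw.mul {f g : AddMonoidAlgebra ℝ E} (hf : IsLaw f) (hg : IsLaw g) : IsLaw (f * g) where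
  nonneg x := by
    rw [coeff_mul_eq_sum]
    exact Finset.sum_nonneg fun y _ => mul_nonneg (hf.nonneg _) (hg.nonneg _)
  total := by rw [expect_mul, hg.total, hf.total]

lemma IsLaw.one : IsLaw (1 : AddMonoidAlgebra ℝ E) where
  nonneg x := by
    classical
    rw [one_def, coeff_single, Finsupp.single_apply]
    split_ifs <;> norm_num
  total := by rw [one_def, expect_single, one_mul]

lemma IsLaw.prod {ι : Type*} {s : Finset ι} {f : ι → AddMonoidAlgebra ℝ E}
    (hf : ∀ i ∈ s, IsLaw (f i)) : IsLaw (∏ i ∈ s, f i) :=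
  Finset.prod_induction _ IsLaw (fun _ _ => IsLaw.mul) IsLaw.one hf

/-- Convolution concentrates at least as much as independence forces it to: if `Y` and `Z` are
independent then `Pr(Y = y) Pr(Z = z) ≤ Pr(Y + Z = y + z)`. -/
lemma IsLaw.coeff_mul_coeff_le {f g : AddMonoidAlgebra ℝ E} (hf : IsLaw f) (hg : IsLaw g)
    (y z : E) : f.coeff y * g.coeff z ≤ (f * g).coeff (y + z) := by
  rw [coeff_mul_eq_sum]
  by_cases hy : y ∈ f.coeff.support
  · refine le_trans (le_of_eq ?_) (Finset.single_le_sum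
      (f := fun x => f.coeff x * g.coeff (y + z - x))
      (fun x _ => mul_nonneg (hf.nonneg _) (hg.nonneg _)) hy)
    simp
  · rw [Finsupp.notMem_support_iff.1 hy, zero_mul]
    exact Finset.sum_nonneg fun y _ => mul_nonneg (hf.nonneg _) (hg.nonneg _)

end Expectation

/-! ### Moments of the conditional probability -/

section Split

open Classical in
/-- If each weight is at most `c`, then `k` independent draws are distinct and all land in `T`
with probability at least `(g(T) - k c)^k`: each draw avoids the earlier ones except with
probability `k c`. -/
lemma pow_le_sum_injective {E : Type*} (T : Finset E) (g : E → ℝ) (hg : ∀ x, 0 ≤ g x) {c u : ℝ}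
    (hc0 : 0 ≤ c) (hc : ∀ x, g x ≤ c) (hu : 0 ≤ u) {k : ℕ} (hT : u + k * c ≤ ∑ x ∈ T, g x) :
    u ^ k ≤ ∑ z ∈ Fintype.piFinset (fun _ : Fin k => T) with Function.Injective z,
      ∏ i, g (z i) := by
  suffices h : ∀ j ≤ k, u ^ j ≤
      ∑ z ∈ Fintype.piFinset (fun _ : Fin j => T) with Function.Injective z, ∏ i, g (z i) from
    h k le_rfl
  intro j
  induction j with
  | zero => intro _; simp [Finset.filter_true_of_mem, Function.injective_of_subsingleton]
  | succ j ih =>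
    intro hj
    -- split off the draw with index `0`
    have key : ∑ z ∈ Fintype.piFinset (fun _ : Fin (j + 1) => T) with Function.Injective z,
        ∏ i, g (z i) = ∑ z ∈ Fintype.piFinset (fun _ : Fin j => T) with Function.Injective z,
          ∑ x ∈ T with x ∉ Set.range z, g x * ∏ i, g (z i) := by
      rw [Finset.sum_sigma']
      refine Finset.sum_bij' (fun z _ => ⟨Fin.tail z, z 0⟩) (fun p _ => Fin.cons p.2 p.1)
        ?_ ?_ ?_ ?_ ?_
      · intro z hz
        simp only [Finset.mem_filter, Fintype.mem_piFinset, Finset.mem_sigma] at hz ⊢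
        obtain ⟨hz, hi⟩ := hz
        rw [← Fin.cons_self_tail z, Fin.cons_injective_iff] at hi
        exact ⟨⟨fun i => hz _, hi.2⟩, hz 0, hi.1⟩
      · intro p hp
        simp only [Finset.mem_filter, Fintype.mem_piFinset, Finset.mem_sigma] at hp ⊢
        refine ⟨fun i => ?_, Fin.cons_injective_iff.2 ⟨hp.2.2, hp.1.2⟩⟩
        refine Fin.cases ?_ (fun i => ?_) i
        · simpa using hp.2.1
        · simpa using hp.1.1 i
      · intro z _
        exact Fin.cons_self_tail z
      · intro p _
        simp
      · intro z _
        rw [Fin.prod_univ_succ]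
        rfl
    rw [key, pow_succ]
    calc u ^ j * u ≤ (∑ z ∈ Fintype.piFinset (fun _ : Fin j => T) with Function.Injective z,
          ∏ i, g (z i)) * u := mul_le_mul_of_nonneg_right (ih (by omega)) hu
      _ ≤ _ := by
        rw [Finset.sum_mul]
        refine Finset.sum_le_sum fun z hz => ?_
        rw [← Finset.sum_mul, mul_comm]
        refine mul_le_mul_of_nonneg_right ?_ (Finset.prod_nonneg fun i _ => hg _)
        have h1 := Finset.sum_filter_add_sum_filter_not T (fun x => x ∉ Set.range z) g
        have h2 : ∑ x ∈ T with ¬ (x ∉ Set.range z), g x ≤ ∑ x ∈ Finset.univ.image z, g x := by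
          refine Finset.sum_le_sum_of_subset_of_nonneg ?_ fun x _ _ => hg x
          intro x hx
          simp only [Finset.mem_filter, not_not, Set.mem_range] at hx
          simpa using hx.2
        have h3 : ∑ x ∈ Finset.univ.image z, g x ≤ (Finset.univ.image z).card • c :=
          Finset.sum_le_card_nsmul _ _ _ fun x _ => hc x
        have h4 : ((Finset.univ.image z).card : ℝ) ≤ k := by
          have := (Finset.card_image_le (s := Finset.univ) (f := z))
          simp only [Finset.card_univ, Fintype.card_fin] at this
          exact_mod_cast this.trans (by omega)
        have h5 := mul_le_mul_of_nonneg_right h4 hc0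
        rw [nsmul_eq_mul] at h3
        linarith

open Classical in
/-- If `k` distinct translates of `S` by vectors of `V` meet `V` in at most `D` points, and the
independent random vectors `Y ∼ f` and `Z ∼ g` in `V` satisfy `Pr(Y = y) ≤ 2 c ^ k` and
`Pr(Z = z) ≤ c`, then `Pr(Y + Z ∈ S) = O(c)`. This compares the `k`-th moment over `Y` of the
conditional probability `Pr(Y + Z ∈ S | Y)` with the probability that `Y + Z₁, …, Y + Z_k ∈ S`
for independent copies `Z_i` of `Z`. -/
lemma expect_mul_indicator_le {E : Type*} [AddCommGroup E] [Module ℝ E] (V : Submodule ℝ E)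
    (S : Set E) {k D : ℕ} (hk : 1 ≤ k)
    (hS : ∀ z : Fin k → E, Function.Injective z → (∀ i, z i ∈ V) →
      {y | y ∈ V ∧ ∀ i, y + z i ∈ S}.encard ≤ (D : ℕ∞))
    {f g : AddMonoidAlgebra ℝ E} (hf : IsLaw f) (hg : IsLaw g)
    (hfV : ∀ y ∈ f.coeff.support, y ∈ V) (hgV : ∀ z ∈ g.coeff.support, z ∈ V)
    {c : ℝ} (hc : 0 ≤ c) (hfc : ∀ y, f.coeff y ≤ 2 * c ^ k) (hgc : ∀ z, g.coeff z ≤ c) :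
    expect (f * g) (S.indicator 1) ≤ (k + 2 * D + 1) * c := by
  set p : E → ℝ := fun y => expect g fun z => S.indicator 1 (y + z) with hp
  set T : E → Finset E := fun y => g.coeff.support.filter fun z => y + z ∈ S with hT
  have hpT : ∀ y, p y = ∑ z ∈ T y, g.coeff z := fun y => by
    simp only [hp, hT, expect_eq_sum, Finset.sum_filter, Set.indicator_apply, Pi.one_apply,
      mul_ite, mul_one, mul_zero]
  set q : E → ℝ := fun y => max (p y - k * c) 0 with hq
  have hq0 : ∀ y, 0 ≤ q y := fun y => le_max_right _ _
  set Z := (Fintype.piFinset fun _ : Fin k => g.coeff.support).filter Function.Injective with hZ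
  have hw0 : ∀ z : Fin k → E, 0 ≤ ∏ i, g.coeff (z i) :=
    fun z => Finset.prod_nonneg fun i _ => hg.nonneg _
  -- `q y ^ k` is at most the probability that `y + Z i ∈ S` for `k` distinct independent copies
  have hqk : ∀ y, q y ^ k ≤ ∑ z ∈ Z, if ∀ i, y + z i ∈ S then ∏ i, g.coeff (z i) else 0 := by
    intro y
    rcases le_total (p y - k * c) 0 with h | h
    · rw [hq]
      simp only [max_eq_right h]
      rw [zero_pow (by omega)]
      exact Finset.sum_nonneg fun z _ => by split_ifs; exacts [hw0 z, le_rfl]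
    · have := pow_le_sum_injective (T y) g.coeff hg.nonneg hc hgc (hq0 y) (k := k)
        (by simp only [hq, max_eq_left h, ← hpT y]; linarith)
      refine this.trans (le_of_eq ?_)
      rw [← Finset.sum_filter]
      refine Finset.sum_congr ?_ fun _ _ => rfl
      ext z
      simp only [hZ, hT, Finset.mem_filter, Fintype.mem_piFinset, forall_and]
      tauto
  have hZ1 : ∑ z ∈ Z, ∏ i, g.coeff (z i) ≤ 1 := by
    calc ∑ z ∈ Z, ∏ i, g.coeff (z i)
        ≤ ∑ z ∈ Fintype.piFinset (fun _ : Fin k => g.coeff.support), ∏ i, g.coeff (z i) :=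
          Finset.sum_le_sum_of_subset_of_nonneg (Finset.filter_subset _ _) fun z _ _ => hw0 z
      _ = ∏ _i : Fin k, ∑ x ∈ g.coeff.support, g.coeff x :=
          (Finset.prod_univ_sum (fun _ : Fin k => g.coeff.support) fun _ x => g.coeff x).symm
      _ = 1 := by
          have := hg.total
          simp only [expect_eq_sum, mul_one] at this
          simp [this]
  have hmom : expect f (fun y => q y ^ k) ≤ 2 * D * c ^ k := by
    calc expect f (fun y => q y ^ k)
        ≤ expect f fun y => ∑ z ∈ Z, if ∀ i, y + z i ∈ S then ∏ i, g.coeff (z i) else 0 :=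
          expect_mono hf.nonneg hqk
      _ = ∑ z ∈ Z, (∏ i, g.coeff (z i)) *
            ∑ y ∈ f.coeff.support with ∀ i, y + z i ∈ S, f.coeff y := by
          simp only [expect_eq_sum, Finset.mul_sum]
          rw [Finset.sum_comm]
          refine Finset.sum_congr rfl fun z _ => ?_
          rw [Finset.sum_filter]
          refine Finset.sum_congr rfl fun y _ => ?_
          split_ifs
          · ring
          · simp
      _ ≤ ∑ z ∈ Z, (∏ i, g.coeff (z i)) * (2 * D * c ^ k) := by
          refine Finset.sum_le_sum fun z hz => mul_le_mul_of_nonneg_left ?_ (hw0 z)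
          simp only [hZ, Finset.mem_filter, Fintype.mem_piFinset] at hz
          have hcard : ((f.coeff.support.filter fun y => ∀ i, y + z i ∈ S).card : ℕ∞) ≤ D := by
            rw [← Set.encard_coe_eq_coe_finsetCard]
            refine (Set.encard_le_encard ?_).trans (hS z hz.2 fun i => hgV _ (hz.1 i))
            intro y hy
            simp only [Finset.coe_filter, Set.mem_ofPred_eq] at hy
            exact ⟨hfV y hy.1, hy.2⟩
          have hcard' : ((f.coeff.support.filter fun y => ∀ i, y + z i ∈ S).card : ℝ) ≤ D := by
            exact_mod_cast hcard
          refine (Finset.sum_le_card_nsmul _ _ _ fun y _ => hfc y).trans ?_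
          rw [nsmul_eq_mul]
          calc _ ≤ (D : ℝ) * (2 * c ^ k) := mul_le_mul_of_nonneg_right hcard' (by positivity)
            _ = _ := by ring
      _ ≤ 2 * D * c ^ k := by
          rw [← Finset.sum_mul]
          exact mul_le_of_le_one_left (by positivity) hZ1
  have hjensen : expect f q ^ k ≤ expect f fun y => q y ^ k :=
    Real.pow_arith_mean_le_arith_mean_pow _ _ _ (fun y _ => hf.nonneg y)
      (by simpa [expect_eq_sum] using hf.total) (fun y _ => hq0 y) k
  have hexp : expect f q ≤ (2 * D + 1) * c := by
    refine le_of_pow_le_pow_left₀ (by omega : k ≠ 0) (by positivity) ?_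
    refine (hjensen.trans hmom).trans ?_
    rw [mul_pow]
    refine mul_le_mul_of_nonneg_right ?_ (by positivity)
    calc (2 * D : ℝ) ≤ 2 * D + 1 := by linarith
      _ ≤ _ := le_self_pow₀ (by linarith [Nat.cast_nonneg (α := ℝ) D]) (by omega)
  rw [expect_mul]
  calc expect f p ≤ expect f fun y => k * c + q y :=
        expect_mono hf.nonneg fun y => by linarith [le_max_left (p y - k * c) 0]
    _ = k * c + expect f q := by
        have := hf.total
        simp only [expect_eq_sum, mul_one] at this
        simp only [expect_eq_sum, mul_add, Finset.sum_add_distrib, ← Finset.sum_mul, this, one_mul]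
    _ ≤ _ := by linarith

end Split

/-! ### A Hölder inequality for convolutions -/

section Symmetric

variable {E : Type*} [AddCommGroup E]

/-- `f` is invariant under `x ↦ -x`. -/
def IsSymm (f : AddMonoidAlgebra ℝ E) : Prop := ∀ x, f.coeff (-x) = f.coeff x

/-- A group algebra element is symmetric iff it pairs equally with `φ` and `φ ∘ neg`. -/
lemma isSymm_iff_expect (f : AddMonoidAlgebra ℝ E) :
    IsSymm f ↔ ∀ φ : E → ℝ, expect f (fun x => φ (-x)) = expect f φ := by
  classical
  constructor
  · intro hf φ
    simp only [expect_eq_sum]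
    refine Finset.sum_bij' (fun x _ => -x) (fun x _ => -x) ?_ ?_ ?_ ?_ ?_
    · intro x hx; simpa [hf x] using hx
    · intro x hx; simpa [hf x] using hx
    · simp
    · simp
    · intro x _; rw [hf x]
  · intro h x
    rw [← expect_indicator_singleton f x, ← expect_indicator_singleton f (-x), ← h]
    simp only [neg_inj]

lemma IsSymm.mul {f g : AddMonoidAlgebra ℝ E} (hf : IsSymm f) (hg : IsSymm g) :
    IsSymm (f * g) := by
  rw [isSymm_iff_expect] at *
  intro φ
  rw [expect_mul, expect_mul, ← hf fun x => expect g fun y => φ (x + y)]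
  congr 1
  ext x
  rw [← hg fun y => φ (-x + y)]
  simp only [neg_add]

lemma IsSymm.one : IsSymm (1 : AddMonoidAlgebra ℝ E) := by
  rw [isSymm_iff_expect]
  intro φ
  simp [one_def, expect_single]

lemma IsSymm.prod {ι : Type*} {s : Finset ι} {f : ι → AddMonoidAlgebra ℝ E}
    (hf : ∀ i ∈ s, IsSymm (f i)) : IsSymm (∏ i ∈ s, f i) :=
  Finset.prod_induction _ IsSymm (fun _ _ => IsSymm.mul) IsSymm.one hf

lemma IsSymm.pow {f : AddMonoidAlgebra ℝ E} (hf : IsSymm f) (m : ℕ) : IsSymm (f ^ m) := by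
  rw [← Fin.prod_const]
  exact IsSymm.prod fun _ _ => hf

lemma IsSymm.coeff_sq_zero {f : AddMonoidAlgebra ℝ E} (hf : IsSymm f) :
    (f ^ 2).coeff 0 = ∑ x ∈ f.coeff.support, f.coeff x ^ 2 := by
  rw [pow_two, coeff_mul_eq_sum]
  refine Finset.sum_congr rfl fun x _ => ?_
  rw [zero_sub, hf, pow_two]

lemma IsSymm.coeff_sq_zero_nonneg {f : AddMonoidAlgebra ℝ E} (hf : IsSymm f) :
    0 ≤ (f ^ 2).coeff 0 := by
  rw [hf.coeff_sq_zero]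
  positivity

/-- The Cauchy–Schwarz inequality for convolutions. -/
lemma sq_coeff_mul_le {f g : AddMonoidAlgebra ℝ E} (hf : IsSymm f) (hg : IsSymm g) (x : E) :
    (f * g).coeff x ^ 2 ≤ (f ^ 2).coeff 0 * (g ^ 2).coeff 0 := by
  classical
  rw [coeff_mul_eq_sum, hf.coeff_sq_zero, hg.coeff_sq_zero]
  refine (Finset.sum_mul_sq_le_sq_mul_sq _ _ _).trans
    (mul_le_mul_of_nonneg_left ?_ (by positivity))
  have hinj : Set.InjOn (fun y => x - y) (f.coeff.support : Set E) :=
    fun y _ z _ h => sub_right_injective h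
  rw [← Finset.sum_image (f := fun y => g.coeff y ^ 2) hinj, ← Finset.sum_inter_add_sum_sdiff _
    g.coeff.support]
  have h0 : ∑ y ∈ f.coeff.support.image (fun y => x - y) \ g.coeff.support, g.coeff y ^ 2 = 0 := by
    refine Finset.sum_eq_zero fun y hy => ?_
    rw [Finsupp.notMem_support_iff.1 (Finset.mem_sdiff.1 hy).2, zero_pow two_ne_zero]
  rw [h0, add_zero]
  exact Finset.sum_le_sum_of_subset_of_nonneg Finset.inter_subset_right fun y _ _ => sq_nonneg _

/-- A Hölder inequality for convolutions of `2 ^ (s + 1)` symmetric factors, which replaces the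
Fourier-analytic one: iterating Cauchy–Schwarz turns the product of distinct factors
into products of equal ones. -/
lemma coeff_prod_pow_le {ι : Type*} (s : ℕ) (J : Finset ι) (hJ : J.card = 2 ^ (s + 1))
    (f : ι → AddMonoidAlgebra ℝ E) (hf : ∀ j ∈ J, IsSymm (f j)) (x : E) :
    (∏ j ∈ J, f j).coeff x ^ 2 ^ (s + 1) ≤ ∏ j ∈ J, (f j ^ 2 ^ (s + 1)).coeff 0 := by
  classical
  induction s generalizing J f x with
  | zero =>
    -- the exponent starts at `2`: for a single factor the bound by the value at `0` can fail
    obtain ⟨i, j, hij, rfl⟩ := Finset.card_eq_two.1 hJ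
    rw [Finset.prod_pair hij, Finset.prod_pair hij]
    exact sq_coeff_mul_le (hf i (by simp)) (hf j (by simp)) x
  | succ s ih =>
    obtain ⟨A, hAJ, hA⟩ := Finset.exists_subset_card_eq (s := J) (n := 2 ^ (s + 1))
      (by rw [hJ]; exact Nat.pow_le_pow_right two_pos (by omega))
    have hB : (J \ A).card = 2 ^ (s + 1) := by
      rw [Finset.card_sdiff_of_subset hAJ, hJ, hA, pow_succ]
      omega
    have hfA : ∀ j ∈ A, IsSymm (f j) := fun j hj => hf j (hAJ hj)
    have hfB : ∀ j ∈ J \ A, IsSymm (f j) := fun j hj => hf j (Finset.sdiff_subset hj)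
    rw [← Finset.prod_sdiff hAJ, ← Finset.prod_sdiff hAJ (f := fun j => (f j ^ 2 ^ _).coeff 0)]
    have h1 := sq_coeff_mul_le (IsSymm.prod hfB) (IsSymm.prod hfA) x
    have h2 : ∀ K : Finset ι, K.card = 2 ^ (s + 1) → (∀ j ∈ K, IsSymm (f j)) →
        ((∏ j ∈ K, f j) ^ 2).coeff 0 ^ 2 ^ (s + 1) ≤ ∏ j ∈ K, (f j ^ 2 ^ (s + 1 + 1)).coeff 0 := by
      intro K hK hfK
      have := ih K hK (fun j => f j ^ 2) (fun j hj => (hfK j hj).pow 2) 0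
      simp only [← pow_mul, Finset.prod_pow] at this
      rwa [show 2 ^ (s + 1 + 1) = 2 * 2 ^ (s + 1) by ring]
    calc _ = ((∏ j ∈ J \ A, f j) * ∏ j ∈ A, f j).coeff x ^ (2 * 2 ^ (s + 1)) := by ring_nf
      _ ≤ (((∏ j ∈ J \ A, f j) ^ 2).coeff 0 * ((∏ j ∈ A, f j) ^ 2).coeff 0) ^ 2 ^ (s + 1) := by
        rw [pow_mul]
        exact pow_le_pow_left₀ (sq_nonneg _) h1 _
      _ ≤ _ := by
        rw [mul_pow]
        refine mul_le_mul (h2 _ hB hfB) (h2 _ hA hfA)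
          (pow_nonneg (IsSymm.prod hfA).coeff_sq_zero_nonneg _) ?_
        exact (pow_nonneg (IsSymm.prod hfB).coeff_sq_zero_nonneg _).trans (h2 _ hB hfB)

end Symmetric

/-! ### Laws supported in independent subspaces -/

section Support

variable {E : Type*} [AddCommGroup E] [Module ℝ E]

/-- `f` is supported in the subspace `V`. -/
def SupportedIn (V : Submodule ℝ E) (f : AddMonoidAlgebra ℝ E) : Prop :=
  ∀ x, f.coeff x ≠ 0 → x ∈ V

lemma SupportedIn.mono {V W : Submodule ℝ E} (h : V ≤ W) {f : AddMonoidAlgebra ℝ E}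
    (hf : SupportedIn V f) : SupportedIn W f := fun x hx => h (hf x hx)

lemma SupportedIn.mul {V : Submodule ℝ E} {f g : AddMonoidAlgebra ℝ E} (hf : SupportedIn V f)
    (hg : SupportedIn V g) : SupportedIn V (f * g) := by
  intro x hx
  rw [coeff_mul_eq_sum] at hx
  obtain ⟨y, _, hy⟩ := Finset.exists_ne_zero_of_sum_ne_zero hx
  simpa using V.add_mem (hg _ (right_ne_zero_of_mul hy)) (hf _ (left_ne_zero_of_mul hy))

lemma SupportedIn.one {V : Submodule ℝ E} : SupportedIn V (1 : AddMonoidAlgebra ℝ E) := by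
  classical
  intro x hx
  rw [one_def, coeff_single, Finsupp.single_apply] at hx
  by_cases h : 0 = x
  · rw [← h]; exact V.zero_mem
  · simp [h] at hx

lemma SupportedIn.prod {V : Submodule ℝ E} {ι : Type*} {s : Finset ι}
    {f : ι → AddMonoidAlgebra ℝ E} (hf : ∀ i ∈ s, SupportedIn V (f i)) :
    SupportedIn V (∏ i ∈ s, f i) :=
  Finset.prod_induction _ (SupportedIn V) (fun _ _ => SupportedIn.mul) SupportedIn.one hf

lemma SupportedIn.pow {V : Submodule ℝ E} {f : AddMonoidAlgebra ℝ E} (hf : SupportedIn V f)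
    (m : ℕ) : SupportedIn V (f ^ m) := by
  rw [← Fin.prod_const]
  exact SupportedIn.prod fun _ _ => hf

/-- A sum of two vectors from independent subspaces vanishes only if both vectors do. -/
lemma coeff_mul_zero_of_disjoint {V W : Submodule ℝ E} (h : Disjoint V W)
    {f g : AddMonoidAlgebra ℝ E} (hf : SupportedIn V f) (hg : SupportedIn W g) :
    (f * g).coeff 0 = f.coeff 0 * g.coeff 0 := by
  rw [coeff_mul_eq_sum, Finset.sum_eq_single 0]
  · simp
  · intro x _ hx
    by_contra hne
    refine hx (Submodule.disjoint_def.1 h x (hf _ (left_ne_zero_of_mul hne)) ?_)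
    simpa using hg _ (right_ne_zero_of_mul hne)
  · intro h0
    rw [Finsupp.notMem_support_iff.1 h0, zero_mul]

lemma coeff_prod_zero {ι : Type*} {a : ι → E} {s : Finset ι}
    (ha : LinearIndepOn ℝ a (s : Set ι)) {f : ι → AddMonoidAlgebra ℝ E}
    (hf : ∀ i ∈ s, SupportedIn (Submodule.span ℝ {a i}) (f i)) :
    (∏ i ∈ s, f i).coeff 0 = ∏ i ∈ s, (f i).coeff 0 := by
  classical
  induction s using Finset.induction_on with
  | empty => simp [one_def]
  | insert i s hi ih =>
    have ha' : LinearIndepOn ℝ a (insert i (s : Set ι)) := by simpa using ha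
    rw [Finset.prod_insert hi, Finset.prod_insert hi, coeff_mul_zero_of_disjoint
      (V := Submodule.span ℝ {a i}) (W := Submodule.span ℝ (a '' s)) ?_ (hf i (by simp)),
      ih (ha'.mono (by simp)) fun j hj => hf j (by simp [hj])]
    · refine SupportedIn.prod fun j hj => (hf j (by simp [hj])).mono ?_
      exact Submodule.span_mono (by simpa using ⟨j, hj, rfl⟩)
    · rw [linearIndepOn_insert (by simpa using hi)] at ha'
      exact (Submodule.disjoint_span_singleton_of_notMem ha'.2).symm

end Support

/-! ### Point concentration of sums over disjoint bases -/

section Step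

variable {E : Type*} [AddCommGroup E]

/-- The law of `ξ b` for a Rademacher variable `ξ`: mass `1/2` at each of `b` and `-b`. -/
noncomputable def signStep (b : E) : AddMonoidAlgebra ℝ E := single b (1 / 2) + single (-b) (1 / 2)

lemma expect_signStep (b : E) (φ : E → ℝ) :
    expect (signStep b) φ = 1 / 2 * φ b + 1 / 2 * φ (-b) := by
  rw [signStep, expect_add, expect_single, expect_single]

lemma isLaw_signStep (b : E) : IsLaw (signStep b) where
  nonneg x := by
    classical
    simp only [signStep, coeff_add, coeff_single, Finsupp.add_apply, Finsupp.single_apply]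
    split_ifs <;> norm_num
  total := by rw [expect_signStep]; norm_num

lemma isSymm_signStep (b : E) : IsSymm (signStep b) := by
  rw [isSymm_iff_expect]
  intro φ
  rw [expect_signStep, expect_signStep, neg_neg, add_comm]

lemma supportedIn_signStep [Module ℝ E] {V : Submodule ℝ E} {b : E} (hb : b ∈ V) :
    SupportedIn V (signStep b) := by
  classical
  intro x hx
  simp only [signStep, coeff_add, coeff_single, Finsupp.add_apply, Finsupp.single_apply] at hx
  by_cases h1 : b = x
  · exact h1 ▸ hb
  · by_cases h2 : -b = x
    · exact h2 ▸ V.neg_mem hb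
    · simp [h1, h2] at hx

lemma centralBinom_sq_mul_le (r : ℕ) : (2 * r + 1) * r.centralBinom ^ 2 ≤ 16 ^ r := by
  induction r with
  | zero => simp
  | succ r ih =>
    have h := Nat.succ_mul_centralBinom_succ r
    refine Nat.le_of_mul_le_mul_left ?_ (by positivity : 0 < (r + 1) ^ 2)
    calc (r + 1) ^ 2 * ((2 * (r + 1) + 1) * (r + 1).centralBinom ^ 2)
        = (2 * r + 3) * ((r + 1) * (r + 1).centralBinom) ^ 2 := by ring
      _ = 4 * ((2 * r + 3) * (2 * r + 1)) * ((2 * r + 1) * r.centralBinom ^ 2) := by rw [h]; ring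
      _ ≤ 4 * (4 * (r + 1) ^ 2) * 16 ^ r := Nat.mul_le_mul (by nlinarith) ih
      _ = (r + 1) ^ 2 * 16 ^ (r + 1) := by ring

/-- A simple random walk of `2 r` steps returns to its start with probability at most
`(2 r) ^ (-1/2)`. -/
lemma coeff_signStep_pow_le [Module ℝ E] {b : E} (hb : b ≠ 0) {r : ℕ} (hr : 1 ≤ r) :
    (signStep b ^ (2 * r)).coeff 0 ≤ 1 / √((2 * r : ℕ) : ℝ) := by
  have hcoeff : (signStep b ^ (2 * r)).coeff 0 = r.centralBinom / 4 ^ r := by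
    classical
    rw [signStep, add_pow, coeff_sum, Finsupp.finsetSum_apply, Finset.sum_eq_single r]
    · rw [single_pow, single_pow, single_mul_single, ← Nat.cast_comm, ← nsmul_eq_mul, coeff_smul]
      have : r • b + (2 * r - r) • -b = 0 := by
        rw [show 2 * r - r = r by omega]; simp
      rw [this, Finsupp.smul_apply, coeff_single, Finsupp.single_eq_same, Nat.centralBinom,
        show 2 * r - r = r by omega, nsmul_eq_mul, ← pow_add, ← two_mul, pow_mul]
      rw [show (1 / 2 : ℝ) ^ 2 = 4⁻¹ by norm_num, inv_pow, div_eq_mul_inv]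
    · intro j hj hjr
      have hj' : j ≤ 2 * r := by simpa [Nat.lt_succ_iff] using hj
      rw [single_pow, single_pow, single_mul_single, ← Nat.cast_comm, ← nsmul_eq_mul, coeff_smul,
        Finsupp.smul_apply, coeff_single, Finsupp.single_eq_of_ne, smul_zero]
      intro h0
      have h1 : ((j : ℝ) - (2 * r - j : ℕ)) • b = 0 := by
        rw [sub_smul, Nat.cast_smul_eq_nsmul, Nat.cast_smul_eq_nsmul, h0]
        simp [sub_eq_add_neg]
      rw [smul_eq_zero, or_iff_left hb, sub_eq_zero, Nat.cast_inj] at h1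
      omega
    · intro h
      exact absurd (Finset.mem_range.2 (by omega)) h
  rw [hcoeff, div_le_div_iff₀ (by positivity) (by positivity), one_mul]
  refine le_of_pow_le_pow_left₀ two_ne_zero (by positivity) ?_
  rw [mul_pow, Real.sq_sqrt (by positivity), ← pow_mul, mul_comm r, pow_mul]
  have h : ((2 * r + 1 : ℕ) : ℝ) * (r.centralBinom : ℝ) ^ 2 ≤ 16 ^ r := by
    exact_mod_cast centralBinom_sq_mul_le r
  push_cast at h ⊢
  norm_num
  nlinarith [sq_nonneg (r.centralBinom : ℝ)]

/-- Halász's bound: if the steps contain `m = 2 ^ (s + 1)` disjoint linearly independent families of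
`k` vectors, then every point has probability at most `m ^ (-k/2)`. -/
lemma coeff_prod_signStep_le [Module ℝ E] {ι : Type*} (a : ι → E) {s k : ℕ}
    (𝓑 : Finset (Finset ι)) (hcard : 𝓑.card = 2 ^ (s + 1))
    (hind : ∀ B ∈ 𝓑, LinearIndepOn ℝ a (B : Set ι)) (hk : ∀ B ∈ 𝓑, B.card = k) (x : E) :
    (∏ B ∈ 𝓑, ∏ i ∈ B, signStep (a i)).coeff x ≤ (1 / √((2 ^ (s + 1) : ℕ) : ℝ)) ^ k := by
  have hsymm : ∀ B : Finset ι, IsSymm (∏ i ∈ B, signStep (a i)) :=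
    fun B => IsSymm.prod fun i _ => isSymm_signStep _
  have h := coeff_prod_pow_le s 𝓑 hcard (fun B => ∏ i ∈ B, signStep (a i)) (fun B _ => hsymm B) x
  refine le_of_pow_le_pow_left₀ (n := 2 ^ (s + 1)) (by positivity) (by positivity) (h.trans ?_)
  rw [← hcard, ← Finset.prod_const, hcard]
  refine Finset.prod_le_prod ?_ fun B hB => ?_
  · intro B _
    rw [pow_succ, pow_mul]
    exact ((hsymm B).pow _).coeff_sq_zero_nonneg
  · rw [← Finset.prod_pow, coeff_prod_zero (hind B hB) fun i _ =>
      (supportedIn_signStep (Submodule.mem_span_singleton_self _)).pow _, ← hk B hB,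
      ← Finset.prod_const]
    refine Finset.prod_le_prod ?_ fun i hi => ?_
    · intro i _
      rw [pow_succ, pow_mul]
      exact ((isSymm_signStep _).pow _).coeff_sq_zero_nonneg
    · rw [pow_succ, mul_comm]
      exact coeff_signStep_pow_le ((hind B hB).ne_zero hi) Nat.one_le_two_pow

end Step

/-! ### Disjoint bases of a common subspace -/

section DisjointBases

variable {E : Type*} [AddCommGroup E] [Module ℝ E] {ι : Type*}

/-- The finite sets of indices in `𝓑` are pairwise disjoint, contained in `I`, and each of them
indexes a basis of `V` among the vectors `a i`. -/
structure IsDisjointBases (a : ι → E) (I : Finset ι) (V : Submodule ℝ E)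
    (𝓑 : Finset (Finset ι)) : Prop where
  subset : ∀ B ∈ 𝓑, B ⊆ I
  disjoint : (𝓑 : Set (Finset ι)).PairwiseDisjoint id
  linearIndepOn : ∀ B ∈ 𝓑, LinearIndepOn ℝ a (B : Set ι)
  span_eq : ∀ B ∈ 𝓑, Submodule.span ℝ (a '' (B : Set ι)) = V

lemma IsDisjointBases.card_eq {a : ι → E} {I : Finset ι} {V : Submodule ℝ E}
    {𝓑 : Finset (Finset ι)} (h : IsDisjointBases a I V 𝓑) {B : Finset ι} (hB : B ∈ 𝓑) :
    B.card = Module.finrank ℝ V := by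
  rw [← h.span_eq B hB]
  have := finrank_span_eq_card (h.linearIndepOn B hB)
  rw [← Set.image_eq_range] at this
  simpa using this.symm

lemma IsDisjointBases.of_subset {a : ι → E} {I : Finset ι} {V : Submodule ℝ E}
    {𝓐 𝓑 : Finset (Finset ι)} (h : IsDisjointBases a I V 𝓑) (hs : 𝓐 ⊆ 𝓑) :
    IsDisjointBases a I V 𝓐 where
  subset B hB := h.subset B (hs hB)
  disjoint := h.disjoint.subset (by exact_mod_cast hs)
  linearIndepOn B hB := h.linearIndepOn B (hs hB)
  span_eq B hB := h.span_eq B (hs hB)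

lemma IsDisjointBases.mono {a : ι → E} {I J : Finset ι} {V : Submodule ℝ E}
    {𝓑 : Finset (Finset ι)} (h : IsDisjointBases a I V 𝓑) (hs : I ⊆ J) :
    IsDisjointBases a J V 𝓑 where
  subset B hB := (h.subset B hB).trans hs
  disjoint := h.disjoint
  linearIndepOn := h.linearIndepOn
  span_eq := h.span_eq

open Classical in
/-- Greedy extraction of bases of `V ≠ ⊥`: it yields `N` of them unless the indices that remain at
some earlier stage span a proper subspace. -/
lemma exists_isDisjointBases_or {a : ι → E} {I : Finset ι} {V : Submodule ℝ E} (hV : V ≠ ⊥)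
    (hI : ∀ i ∈ I, a i ∈ V) (N : ℕ) :
    (∃ 𝓑, 𝓑.card = N ∧ IsDisjointBases a I V 𝓑) ∨
      ∃ I' ⊆ I, Submodule.span ℝ (a '' (I' : Set ι)) < V ∧
        I.card ≤ I'.card + N * Module.finrank ℝ V := by
  induction N with
  | zero => exact Or.inl ⟨∅, rfl, by simp, by simp, by simp, by simp⟩
  | succ N ih =>
    rcases ih with ⟨𝓑, hN, h𝓑⟩ | ⟨I', hI', hlt, hc⟩
    swap
    · exact Or.inr ⟨I', hI', hlt, hc.trans (by gcongr; omega)⟩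
    have hle : Submodule.span ℝ (a '' ((I \ 𝓑.biUnion id : Finset ι) : Set ι)) ≤ V := by
      rw [Submodule.span_le]
      rintro _ ⟨i, hi, rfl⟩
      exact hI i (Finset.mem_sdiff.1 (Finset.mem_coe.1 hi)).1
    rcases hle.lt_or_eq with hlt | heq
    · refine Or.inr ⟨_, Finset.sdiff_subset, hlt, ?_⟩
      have h1 := Finset.le_card_sdiff (𝓑.biUnion id) I
      have h2 : (𝓑.biUnion id).card ≤ 𝓑.card * Module.finrank ℝ V :=
        Finset.card_biUnion_le_card_mul _ _ _ fun B hB => (h𝓑.card_eq hB).le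
      rw [hN] at h2
      have h3 : N * Module.finrank ℝ V ≤ (N + 1) * Module.finrank ℝ V := by gcongr; omega
      omega
    · obtain ⟨b, hbI, -, hsp, hli⟩ := exists_linearIndepOn_extension
        (linearIndepOn_empty ℝ a) (Set.empty_subset ((I \ 𝓑.biUnion id : Finset ι) : Set ι))
      obtain ⟨B, rfl⟩ : ∃ B : Finset ι, (B : Set ι) = b :=
        ((Finset.finite_toSet _).subset hbI).exists_finset_coe
      have hBI : B ⊆ I \ 𝓑.biUnion id := by exact_mod_cast hbI
      have hspB : Submodule.span ℝ (a '' (B : Set ι)) = V :=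
        heq ▸ le_antisymm (Submodule.span_mono (Set.image_mono hbI)) (Submodule.span_le.2 hsp)
      have hne : B.Nonempty := by
        rw [Finset.nonempty_iff_ne_empty]
        rintro rfl
        exact hV (by simpa using hspB.symm)
      have hdisj : ∀ A ∈ 𝓑, Disjoint B A := by
        intro A hA
        rw [Finset.disjoint_left]
        intro i hiB hiA
        exact (Finset.mem_sdiff.1 (hBI hiB)).2 (Finset.mem_biUnion.2 ⟨A, hA, hiA⟩)
      have hB𝓑 : B ∉ 𝓑 := fun h => hne.ne_empty (by simpa using hdisj B h)
      refine Or.inl ⟨insert B 𝓑, by rw [Finset.card_insert_of_notMem hB𝓑, hN], ?_, ?_, ?_, ?_⟩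
      · simpa using ⟨hBI.trans Finset.sdiff_subset, h𝓑.subset⟩
      · rw [Finset.coe_insert]
        exact h𝓑.disjoint.insert fun A hA _ => hdisj A hA
      · simpa using ⟨hli, h𝓑.linearIndepOn⟩
      · simpa using ⟨hspB, h𝓑.span_eq⟩

/-- Among sufficiently many nonzero vectors there are `N` disjoint bases of one common nonzero
subspace. If the greedy extraction fails in the span of the vectors, most of
the vectors lie in a space of smaller dimension. -/
lemma exists_isDisjointBases [FiniteDimensional ℝ E] {a : ι → E} (ha : ∀ i, a i ≠ 0) (N : ℕ)
    (I : Finset ι) (hI : N * Module.finrank ℝ E ^ 2 < I.card) :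
    ∃ V : Submodule ℝ E, V ≠ ⊥ ∧ ∃ 𝓑, 𝓑.card = N ∧ IsDisjointBases a I V 𝓑 := by
  set d := Module.finrank ℝ E with hd
  suffices h : ∀ k (I : Finset ι), Module.finrank ℝ (Submodule.span ℝ (a '' (I : Set ι))) = k →
      N * d * k < I.card →
      ∃ V : Submodule ℝ E, V ≠ ⊥ ∧ ∃ 𝓑, 𝓑.card = N ∧ IsDisjointBases a I V 𝓑 by
    refine h _ I rfl (lt_of_le_of_lt ?_ hI)
    rw [pow_two, ← mul_assoc]
    exact Nat.mul_le_mul_left _ (Submodule.finrank_le _)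
  intro k
  induction k using Nat.strong_induction_on with
  | _ k ih =>
    intro I hk hI
    obtain ⟨i, hi⟩ := Finset.card_pos.1 (Nat.zero_lt_of_lt hI)
    set V := Submodule.span ℝ (a '' (I : Set ι))
    have hIV : ∀ i ∈ I, a i ∈ V := fun i hi => Submodule.subset_span ⟨i, hi, rfl⟩
    have hV : V ≠ ⊥ := fun h => ha i (by simpa [h] using hIV i hi)
    rcases exists_isDisjointBases_or hV hIV N with h | ⟨I', hI', hlt, hc⟩
    · exact ⟨V, hV, h⟩
    · have hk' := Submodule.finrank_lt_finrank_of_lt hlt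
      have hVd : Module.finrank ℝ V ≤ d := Submodule.finrank_le V
      obtain ⟨W, hW, 𝓑, hN, h𝓑⟩ := ih _ (by rwa [hk] at hk') I' rfl (by
        have h1 : N * Module.finrank ℝ V ≤ N * d := Nat.mul_le_mul_left _ hVd
        have h2 : N * d * (Module.finrank ℝ (Submodule.span ℝ (a '' (I' : Set ι))) + 1) ≤
            N * d * k := Nat.mul_le_mul_left _ (by omega)
        rw [mul_add, mul_one] at h2
        omega)
      exact ⟨W, hW, 𝓑, hN, h𝓑.mono hI'⟩

end DisjointBases

/-! ### Bounds for signed sums -/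

section SignedSums

variable {E : Type*} [AddCommGroup E] {ι : Type*}

/-- Adding one step at most halves the point concentration, so some partial sum has concentration
between `r / 2` and `r`, provided that the concentration of the whole sum is at most `r`. -/
lemma exists_subset_concentration {a : ι → E} {r : ℝ} (hr : r ≤ 1) (J : Finset ι)
    (hJ : ∀ x, (∏ i ∈ J, signStep (a i)).coeff x ≤ r) :
    ∃ I ⊆ J, (∀ x, (∏ i ∈ I, signStep (a i)).coeff x ≤ r) ∧
      ∃ x, r / 2 ≤ (∏ i ∈ I, signStep (a i)).coeff x := by
  classical
  induction J using Finset.induction_on with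
  | empty =>
    refine ⟨∅, le_rfl, hJ, 0, ?_⟩
    have := hJ 0
    simp only [Finset.prod_empty, one_def, coeff_single, Finsupp.single_eq_same] at this ⊢
    linarith
  | insert j J hj ih =>
    by_cases h : ∀ x, (∏ i ∈ J, signStep (a i)).coeff x ≤ r
    · obtain ⟨I, hI, hI'⟩ := ih h
      exact ⟨I, hI.trans (Finset.subset_insert _ _), hI'⟩
    · push Not at h
      obtain ⟨x, hx⟩ := h
      refine ⟨insert j J, le_rfl, hJ, a j + x, ?_⟩
      rw [Finset.prod_insert hj]
      refine le_trans ?_ (IsLaw.coeff_mul_coeff_le (isLaw_signStep _)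
        (IsLaw.prod fun i _ => isLaw_signStep _) _ _)
      have h1 : 1 / 2 ≤ (signStep (a j)).coeff (a j) := by
        simp only [signStep, coeff_add, coeff_single, Finsupp.add_apply, Finsupp.single_apply]
        split_ifs <;> norm_num
      have h2 : 0 ≤ (∏ i ∈ J, signStep (a i)).coeff x :=
        (IsLaw.prod fun i _ => isLaw_signStep _).nonneg x
      nlinarith

variable [Module ℝ E] [Fintype ι]

/-- The inverse bound: with `ρ = r ^ (d + 1)`, the sum splits into a part of concentration about
`r` and a part which then has concentration at most `2 r ^ d`. -/
lemma expect_prod_signStep_le_of_concentration {S : Set E} {D : ℕ}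
    (hd : 1 ≤ Module.finrank ℝ E)
    (hS : ∀ z : Fin (Module.finrank ℝ E) → E, Function.Injective z →
      {y | ∀ i, y + z i ∈ S}.encard ≤ (D : ℕ∞))
    (a : ι → E) {r : ℝ} (hr0 : 0 < r) (hr1 : r ≤ 1)
    (hr : ∀ x, (∏ i, signStep (a i)).coeff x ≤ r ^ (Module.finrank ℝ E + 1)) :
    expect (∏ i, signStep (a i)) (S.indicator 1) ≤ (Module.finrank ℝ E + 2 * D + 1) * r := by
  classical
  obtain ⟨I, -, hI, x, hx⟩ := exists_subset_concentration hr1 Finset.univ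
    fun x => (hr x).trans (pow_le_of_le_one hr0.le hr1 (by omega))
  have hlaw : ∀ J : Finset ι, IsLaw (∏ i ∈ J, signStep (a i)) :=
    fun J => IsLaw.prod fun i _ => isLaw_signStep _
  have hsplit : ∏ i, signStep (a i) =
      (∏ i ∈ Finset.univ \ I, signStep (a i)) * ∏ i ∈ I, signStep (a i) :=
    (Finset.prod_sdiff (Finset.subset_univ I)).symm
  rw [hsplit] at hr ⊢
  refine expect_mul_indicator_le ⊤ S hd (fun z hz _ => by simpa using hS z hz) (hlaw _) (hlaw _)
    (fun _ _ => trivial) (fun _ _ => trivial) hr0.le (fun y => ?_) hI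
  have h1 := (IsLaw.coeff_mul_coeff_le (hlaw (Finset.univ \ I)) (hlaw I) y x).trans (hr _)
  have h2 := mul_le_mul_of_nonneg_left hx ((hlaw (Finset.univ \ I)).nonneg y)
  refine le_of_mul_le_mul_right ?_ (half_pos hr0)
  calc _ ≤ _ := h2.trans h1
    _ = _ := by ring

open Classical in
/-- The `n ^ (-1/2)` bound: splitting a family of disjoint bases of `V` into two
halves gives two independent sums in `V`, both with the point concentration of Halász's bound, and
the other steps only translate `S`. -/
lemma expect_prod_signStep_le_of_card [FiniteDimensional ℝ E] {S : Set E} {D : ℕ}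
    (hS : ∀ V : Submodule ℝ E, V ≠ ⊥ → ∀ (w : E) (z : Fin (Module.finrank ℝ V) → E),
      Function.Injective z → (∀ i, z i ∈ V) →
      {y | y ∈ V ∧ ∀ i, w + (y + z i) ∈ S}.encard ≤ (D : ℕ∞))
    {a : ι → E} (ha : ∀ i, a i ≠ 0) (s : ℕ)
    (hs : 2 ^ (s + 2) * Module.finrank ℝ E ^ 2 < Fintype.card ι) :
    expect (∏ i, signStep (a i)) (S.indicator 1) ≤
      (Module.finrank ℝ E + 2 * D + 1) * (1 / √((2 ^ (s + 1) : ℕ) : ℝ)) := by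
  obtain ⟨V, hV, 𝓑, hcard, h𝓑⟩ := exists_isDisjointBases ha (2 ^ (s + 2)) Finset.univ hs
  obtain ⟨𝓐, h𝓐, h𝓐card⟩ := Finset.exists_subset_card_eq (s := 𝓑) (n := 2 ^ (s + 1))
    (by rw [hcard]; exact Nat.pow_le_pow_right two_pos (by omega))
  have hccard : (𝓑 \ 𝓐).card = 2 ^ (s + 1) := by
    rw [Finset.card_sdiff_of_subset h𝓐, hcard, h𝓐card, pow_succ _ (s + 1)]
    omega
  have hk : 1 ≤ Module.finrank ℝ V := Submodule.one_le_finrank_iff.2 hV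
  have hkd : Module.finrank ℝ V ≤ Module.finrank ℝ E := Submodule.finrank_le V
  have hA := h𝓑.of_subset h𝓐
  have hC := h𝓑.of_subset (Finset.sdiff_subset (s := 𝓑) (t := 𝓐))
  have hprod : (∏ i, signStep (a i)) =
      (∏ i ∈ Finset.univ \ 𝓑.biUnion id, signStep (a i)) *
        ((∏ B ∈ 𝓑 \ 𝓐, ∏ i ∈ B, signStep (a i)) * ∏ B ∈ 𝓐, ∏ i ∈ B, signStep (a i)) := by
    rw [Finset.prod_sdiff h𝓐, show ∏ B ∈ 𝓑, ∏ i ∈ B, signStep (a i) =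
      ∏ i ∈ 𝓑.biUnion id, signStep (a i) from (Finset.prod_biUnion h𝓑.disjoint).symm]
    exact (Finset.prod_sdiff (Finset.subset_univ _)).symm
  have hlaw : ∀ 𝓒 : Finset (Finset ι), IsLaw (∏ B ∈ 𝓒, ∏ i ∈ B, signStep (a i)) :=
    fun 𝓒 => IsLaw.prod fun B _ => IsLaw.prod fun i _ => isLaw_signStep _
  have hsupp : ∀ 𝓒 : Finset (Finset ι), IsDisjointBases a Finset.univ V 𝓒 →
      SupportedIn V (∏ B ∈ 𝓒, ∏ i ∈ B, signStep (a i)) := by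
    intro 𝓒 h
    refine SupportedIn.prod fun B hB => SupportedIn.prod fun i hi => supportedIn_signStep ?_
    rw [← h.span_eq B hB]
    exact Submodule.subset_span ⟨i, hi, rfl⟩
  have hconc : ∀ 𝓒 : Finset (Finset ι), IsDisjointBases a Finset.univ V 𝓒 →
      𝓒.card = 2 ^ (s + 1) → ∀ x, (∏ B ∈ 𝓒, ∏ i ∈ B, signStep (a i)).coeff x ≤
        (1 / √((2 ^ (s + 1) : ℕ) : ℝ)) ^ Module.finrank ℝ V :=
    fun 𝓒 h h' => coeff_prod_signStep_le a 𝓒 h' h.linearIndepOn fun B hB => h.card_eq hB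
  set c : ℝ := 1 / √((2 ^ (s + 1) : ℕ) : ℝ)
  have hc0 : 0 ≤ c := by positivity
  have hc1 : c ≤ 1 := by
    refine div_le_one_of_le₀ (Real.one_le_sqrt.2 ?_) (by positivity)
    exact_mod_cast Nat.one_le_two_pow
  rw [hprod, expect_mul]
  refine (IsLaw.prod fun i _ => isLaw_signStep _).expect_le fun w => ?_
  have hcore := expect_mul_indicator_le V {y | w + y ∈ S} hk (hS V hV w) (hlaw (𝓑 \ 𝓐)) (hlaw 𝓐)
    (fun y hy => hsupp _ hC y (Finsupp.mem_support_iff.1 hy))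
    (fun y hy => hsupp _ hA y (Finsupp.mem_support_iff.1 hy)) hc0
    (fun y => (hconc _ hC hccard y).trans (by linarith [pow_nonneg hc0 (Module.finrank ℝ V)]))
    (fun z => (hconc _ hA h𝓐card z).trans (pow_le_of_le_one hc0 hc1 (by omega)))
  refine hcore.trans (mul_le_mul_of_nonneg_right ?_ hc0)
  have : (Module.finrank ℝ V : ℝ) ≤ Module.finrank ℝ E := by exact_mod_cast hkd
  linarith

end SignedSums

/-! ### Signed sums of Rademacher variables -/

section Rademacher

lemma rademacher_singleton {t : ℝ} (ht : t = 1 ∨ t = -1) : rademacher {t} = 2⁻¹ := by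
  rcases ht with rfl | rfl <;> simp [rademacher, Set.indicator_apply] <;> norm_num

lemma rademacher_compl : rademacher ({1, -1}ᶜ : Set ℝ) = 0 := by
  simp [rademacher]

variable {E : Type*} [AddCommGroup E] [Module ℝ E] {ι : Type*} [Fintype ι]

open Classical in
lemma expect_prod_signStep_eq_sum (a : ι → E) (φ : E → ℝ) :
    expect (∏ i, signStep (a i)) φ = ∑ ε ∈ Fintype.piFinset fun _ : ι => ({1, -1} : Finset ℝ),
      (1 / 2) ^ Fintype.card ι * φ (∑ i, ε i • a i) := by
  have h : ∀ i, signStep (a i) = ∑ t ∈ ({1, -1} : Finset ℝ), single (t • a i) (1 / 2) := by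
    intro i
    rw [Finset.sum_pair (by norm_num), signStep, one_smul, neg_one_smul]
  simp only [h]
  rw [Finset.prod_univ_sum, expect_sum]
  refine Finset.sum_congr rfl fun ε _ => ?_
  rw [prod_single, expect_single, Finset.prod_const, Finset.card_univ]

variable {Ω : Type*} [MeasurableSpace Ω] {μ : Measure Ω} [IsProbabilityMeasure μ] {ξ : ι → Ω → ℝ}

/-- The signed sum takes finitely many values almost surely, so its law on an arbitrary,
possibly nonmeasurable, set `S` is given by the group algebra element `∏ i, signStep (a i)`. -/
lemma measureReal_signedSum_mem (hind : iIndepFun ξ μ) (hξ : ∀ i, HasLaw (ξ i) rademacher μ)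
    (a : ι → E) (S : Set E) :
    μ.real {ω | ∑ i, ξ i ω • a i ∈ S} = expect (∏ i, signStep (a i)) (S.indicator 1) := by
  classical
  set P := Fintype.piFinset fun _ : ι => ({1, -1} : Finset ℝ) with hP
  have hval : ∀ᵐ ω ∂μ, ∀ i, ξ i ω = 1 ∨ ξ i ω = -1 := by
    rw [ae_all_iff]
    intro i
    have h : ∀ᵐ t ∂(μ.map (ξ i)), t ∈ ({1, -1} : Set ℝ) := by
      rw [(hξ i).map_eq, ae_iff]
      exact rademacher_compl
    exact ae_of_ae_map (hξ i).aemeasurable h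
  have hset : ({ω | ∑ i, ξ i ω • a i ∈ S} : Set Ω) =ᵐ[μ]
      ⋃ ε ∈ P.filter fun ε => ∑ i, ε i • a i ∈ S, ⋂ i ∈ Finset.univ, ξ i ⁻¹' {ε i} := by
    filter_upwards [hval] with ω hω
    refine propext (Iff.trans ?_ Set.mem_iUnion₂.symm)
    constructor
    · intro h
      refine ⟨fun i => ξ i ω, ?_, by simp⟩
      simp only [hP, Finset.mem_filter, Fintype.mem_piFinset, Finset.mem_insert,
        Finset.mem_singleton]
      exact ⟨hω, h⟩
    · rintro ⟨ε, hε, h⟩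
      have hε' : ∀ i, ξ i ω = ε i := by simpa using h
      have := (Finset.mem_filter.1 hε).2
      simp only [← hε'] at this
      exact this
  have hprob : ∀ ε ∈ P, μ.real (⋂ i ∈ Finset.univ, ξ i ⁻¹' {ε i}) =
      (1 / 2) ^ Fintype.card ι := by
    intro ε hε
    have hi : ∀ i, μ (ξ i ⁻¹' {ε i}) = 2⁻¹ := by
      intro i
      rw [← Measure.map_apply_of_aemeasurable (hξ i).aemeasurable (measurableSet_singleton _),
        (hξ i).map_eq]
      exact rademacher_singleton (by simpa using Fintype.mem_piFinset.1 hε i)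
    rw [measureReal_def, hind.measure_inter_preimage_eq_mul Finset.univ
      fun i _ => measurableSet_singleton (ε i)]
    simp [hi]
  rw [measureReal_congr hset, measureReal_biUnion_finset₀, Finset.sum_congr rfl fun ε hε =>
    hprob ε (Finset.mem_filter.1 hε).1, expect_prod_signStep_eq_sum, Finset.sum_filter]
  · refine Finset.sum_congr rfl fun ε _ => ?_
    simp [Set.indicator_apply]
  · intro ε _ ε' _ hne
    refine Disjoint.aedisjoint (Set.disjoint_left.2 fun ω h h' => hne ?_)
    ext i
    simp only [Finset.mem_univ, Set.iInter_true, Set.mem_iInter, Set.mem_preimage,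
      Set.mem_singleton_iff] at h h'
    rw [← h i, ← h' i]
  · intro ε _
    refine Finset.nullMeasurableSet_biInter _ fun i _ => ?_
    exact (hξ i).aemeasurable.nullMeasurableSet_preimage (measurableSet_singleton _)

lemma coeff_prod_signStep_le_maxPointProb (hind : iIndepFun ξ μ)
    (hξ : ∀ i, HasLaw (ξ i) rademacher μ) (a : ι → E) (x : E) :
    (∏ i, signStep (a i)).coeff x ≤ maxPointProb μ fun ω => ∑ i, ξ i ω • a i := by
  classical
  have h := measureReal_signedSum_mem hind hξ a {x}
  have hx : ({x} : Set E).indicator (1 : E → ℝ) = fun y => if y = x then 1 else 0 := by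
    ext y
    simp [Set.indicator_apply]
  rw [hx, expect_indicator_singleton] at h
  rw [← h]
  exact le_ciSup (f := fun x => μ.real {ω | ∑ i, ξ i ω • a i = x})
    ⟨1, by rintro _ ⟨y, rfl⟩; exact measureReal_le_one⟩ x

end Rademacher

/-! ### The generic intersection property and the choice of constants -/

/-- The generic intersection property in the affine subspace `w + V`, in terms of translates
by vectors of `V`. -/
lemma encard_le_of_forall_affineSubspace {E : Type*} [AddCommGroup E] [Module ℝ E] {S : Set E}
    {D : ℕ}
    (hD : ∀ Λ : AffineSubspace ℝ E, 1 ≤ Module.finrank ℝ Λ.direction →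
      ∀ x : Fin (Module.finrank ℝ Λ.direction) → E, Function.Injective x →
        (⋂ i, {y | y + x i ∈ S ∩ (Λ : Set E)}).encard ≤ (D : ℕ∞))
    {V : Submodule ℝ E} (hV : 1 ≤ Module.finrank ℝ V) (w : E)
    (z : Fin (Module.finrank ℝ V) → E) (hz : Function.Injective z) (hzV : ∀ i, z i ∈ V) :
    {y | y ∈ V ∧ ∀ i, w + (y + z i) ∈ S}.encard ≤ (D : ℕ∞) := by
  have key : ∀ W : Submodule ℝ E, (AffineSubspace.mk' w V).direction = W →
      1 ≤ Module.finrank ℝ W → ∀ x : Fin (Module.finrank ℝ W) → E, Function.Injective x →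
        (⋂ i, {y | y + x i ∈ S ∩ (AffineSubspace.mk' w V : Set E)}).encard ≤ (D : ℕ∞) := by
    rintro _ rfl
    exact hD _
  refine (Set.encard_le_encard ?_).trans (key V (AffineSubspace.direction_mk' w V) hV
    (fun i => w + z i) fun i j h => hz (add_left_cancel h))
  rintro y ⟨hy, hyS⟩
  refine Set.mem_iInter.2 fun i => ?_
  have h : y + (w + z i) = w + (y + z i) := by abel
  refine ⟨show y + (w + z i) ∈ S from h ▸ hyS i, ?_⟩
  show y + (w + z i) ∈ AffineSubspace.mk' w V
  rw [AffineSubspace.mem_mk', h, vsub_eq_sub, add_sub_cancel_left]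
  exact V.add_mem hy (hzV i)

/-- Conversion of the bound in terms of a power of two to a bound in terms of `n`; for the few
`n` that admit no such power of two, the right-hand side is at least `1`. -/
lemma le_mul_rpow_neg_half {K n : ℕ} (hn : 1 ≤ n) {p A : ℝ} (hp : p ≤ 1) (hA : 1 ≤ A)
    (h : ∀ s, K * 2 ^ (s + 1) ≤ n → p ≤ A * (1 / √((2 ^ (s + 1) : ℕ) : ℝ))) (hK : 1 ≤ K) :
    p ≤ A * √(4 * K) * (n : ℝ) ^ (-(1 / 2) : ℝ) := by
  have hn0 : (0 : ℝ) < n := by exact_mod_cast hn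
  have hrw : √(4 * K) * (n : ℝ) ^ (-(1 / 2) : ℝ) = √(4 * K / n) := by
    rw [Real.rpow_neg hn0.le, ← Real.sqrt_eq_rpow, Real.sqrt_div (by positivity), div_eq_mul_inv]
  rw [mul_assoc, hrw]
  by_cases hsmall : n < 2 * K
  · have h1 : 1 ≤ √(4 * K / n) := by
      rw [Real.one_le_sqrt, one_le_div hn0]
      have : (n : ℝ) < 2 * K := by exact_mod_cast hsmall
      linarith [Nat.cast_nonneg (α := ℝ) K]
    nlinarith
  · have hq : 2 ≤ n / K := (Nat.le_div_iff_mul_le hK).2 (by omega)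
    have hlog : 1 ≤ Nat.log 2 (n / K) := Nat.log_pos one_lt_two hq
    obtain ⟨s, hs⟩ : ∃ s, Nat.log 2 (n / K) = s + 1 := ⟨_, (Nat.sub_add_cancel hlog).symm⟩
    have h1 : 2 ^ (s + 1) ≤ n / K := hs ▸ Nat.pow_log_le_self 2 (by omega)
    have h2 : n / K < 2 ^ (s + 1 + 1) := hs ▸ Nat.lt_pow_succ_log_self one_lt_two _
    have h3 : n < 2 ^ (s + 1 + 1) * K := (Nat.div_lt_iff_lt_mul hK).1 h2
    refine (h s ?_).trans (mul_le_mul_of_nonneg_left ?_ (by linarith))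
    · calc K * 2 ^ (s + 1) ≤ K * (n / K) := Nat.mul_le_mul_left _ h1
        _ ≤ n := Nat.mul_div_le n K
    · rw [← Real.sqrt_one, ← Real.sqrt_div zero_le_one]
      refine Real.sqrt_le_sqrt ?_
      rw [div_le_div_iff₀ (by positivity) hn0]
      have : (n : ℝ) < 2 ^ (s + 1 + 1) * K := by exact_mod_cast h3
      have hK0 : (0 : ℝ) ≤ 2 ^ (s + 1) * K := by positivity
      push_cast
      rw [pow_succ _ (s + 1)] at this
      linarith

theorem theorem1p6 {d : ℕ} (S : Set (EuclideanSpace ℝ (Fin d)))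
    (hS : GenericIntersectionProperty S) :
    ∃ C : ℝ, ∀ n : ℕ, 1 ≤ n →
      ∀ a : Fin n → EuclideanSpace ℝ (Fin d), (∀ i, a i ≠ 0) →
      ∀ (Ω : Type*) [MeasurableSpace Ω] (μ : Measure Ω) [IsProbabilityMeasure μ]
        (ξ : Fin n → Ω → ℝ), iIndepFun ξ μ → (∀ i, HasLaw (ξ i) rademacher μ) →
        μ.real {ω | ∑ i, ξ i ω • a i ∈ S} ≤ C * (n : ℝ) ^ (-(1 / 2) : ℝ) ∧
        μ.real {ω | ∑ i, ξ i ω • a i ∈ S} ≤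
          C * maxPointProb μ (fun ω => ∑ i, ξ i ω • a i) ^ (1 / ((d : ℝ) + 1)) := by
  obtain ⟨D, hD⟩ := hS
  set K : ℕ := 2 * d ^ 2 + 1 with hK
  set A : ℝ := d + 2 * D + 1 with hA
  have hA1 : 1 ≤ A := by
    have : (0 : ℝ) ≤ d + 2 * D := by positivity
    linarith
  have hfin : Module.finrank ℝ (EuclideanSpace ℝ (Fin d)) = d := finrank_euclideanSpace_fin
  refine ⟨A * √(4 * K), fun n hn a ha Ω _ μ _ ξ hind hξ => ⟨?_, ?_⟩⟩
  · refine le_mul_rpow_neg_half hn measureReal_le_one hA1 (fun s hs => ?_) (by omega)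
    rw [measureReal_signedSum_mem hind hξ]
    have := expect_prod_signStep_le_of_card (S := S) (D := D) (fun V hV w z hz hzV =>
      encard_le_of_forall_affineSubspace hD (Submodule.one_le_finrank_iff.2 hV) w z hz hzV)
      ha s (by
        rw [hfin, Fintype.card_fin]
        refine lt_of_lt_of_le ?_ hs
        have : 0 < 2 ^ (s + 1) := by positivity
        rw [hK, pow_succ 2 (s + 1)]
        nlinarith)
    rwa [hfin] at this
  · set ρ := maxPointProb μ fun ω => ∑ i, ξ i ω • a i with hρ
    -- in dimension `0` there are no nonzero vectors, so `n ≥ 1` excludes it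
    have hd : 1 ≤ d := by
      by_contra h0
      obtain rfl : d = 0 := by omega
      exact ha ⟨0, hn⟩ (Subsingleton.elim _ _)
    have hcoeff := coeff_prod_signStep_le_maxPointProb hind hξ a
    obtain ⟨x, hx⟩ := (IsLaw.prod fun i (_ : i ∈ Finset.univ) =>
      isLaw_signStep (a i)).exists_coeff_pos
    have hρ0 : 0 < ρ := hx.trans_le (hcoeff x)
    have hρ1 : ρ ≤ 1 := ciSup_le fun x => measureReal_le_one
    set r := ρ ^ (1 / ((d : ℝ) + 1)) with hr
    have hr0 : 0 < r := Real.rpow_pos_of_pos hρ0 _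
    have hr1 : r ≤ 1 := Real.rpow_le_one hρ0.le hρ1 (by positivity)
    have hrρ : r ^ (d + 1) = ρ := by
      rw [hr, one_div, ← Nat.cast_succ]
      exact Real.rpow_inv_natCast_pow hρ0.le (Nat.succ_ne_zero d)
    have hbound := expect_prod_signStep_le_of_concentration (S := S) (D := D)
      (by rwa [hfin]) (fun z hz => by
        have := encard_le_of_forall_affineSubspace hD (V := ⊤) (by rwa [finrank_top, hfin]) 0
          (z ∘ Fin.cast (finrank_top ℝ _)) (hz.comp (Fin.cast_injective _)) fun _ => trivial
        refine (Set.encard_le_encard ?_).trans this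
        exact fun y hy => ⟨trivial, fun i => by simpa using hy _⟩) a hr0 hr1 (by
        rw [hfin, hrρ]
        exact hcoeff)
    rw [hfin, ← measureReal_signedSum_mem hind hξ] at hbound
    refine hbound.trans (mul_le_mul_of_nonneg_right ?_ hr0.le)
    refine le_mul_of_one_le_right (by linarith) (Real.one_le_sqrt.2 ?_)
    have : (1 : ℝ) ≤ K := by exact_mod_cast (by omega : 1 ≤ K)
    linarith
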